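/- Let $r \ge 1$ be an integer. There is a constant $C_r$ depending only on $r$ such that the following holds for every integer $d \ge 0$, every tensor $A = (A_{i_1,\dots,i_r})_{i_1,\dots,i_r \in [d]} \in (\mathbb{R}^d)^{\otimes r}$, all independent standard Gaussian random vectors $g_1,\dots,g_r$ in $\mathbb{R}^d$, and every real $p \ge 2$: \[ \left(\mathbb{E}\left|\sum_{i_1,\dots,i_r\in[d]} A_{i_1,\dots,i_r}\prod_{t=1}^r (g_t)_{i_t}\right|^p\right)^{1/p} \le C_r \sum_{\mathcal{P}\in S(r)} p^{|\mathcal{P}|/2}\,\|A^{\mathcal{P}}\|_{\mathrm{inj}}, \] where the $p$-th moment on the left is finite. Here $S(r)$ is the set of all partitions of $[r]=\{1,\dots,r\}$ into non-empty blocks. For $\mathcal{P}=\{I_1,\dots,I_m\}\in S(r)$, $|\mathcal{P}|=m$ and $A^{\mathcal{P}}$ is the tensor $A$ viewed as an order-$m$ tensor in $\mathbb{R}^{d^{|I_1|}}\otimes\dots\otimes\mathbb{R}^{d^{|I_m|}}$, whose $j$-th index is the tuple $(i_t)_{t\in I_j}$. For a tensor $B\in\mathbb{R}^{d_1}\otimes\dots\otimes\mathbb{R}^{d_m}$,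 the $\ell_2$ injective norm is \[ \|B\|_{\mathrm{inj}} = \sup\left\{\sum_{i_1\in[d_1],\dots,i_m\in[d_m]} B_{i_1,\dots,i_m}\prod_{j=1}^m (x_j)_{i_j} \;:\; x_j\in\mathbb{R}^{d_j},\ \|x_j\|_2\le 1 \text{ for } j=1,\dots,m\right\}. \] -/

import Mathlib

open MeasureTheory ProbabilityTheory

/-- Tensors with (finite) index types `κ a`, one for each mode `a : ι`, given by their entries.
With `ι = Fin r` and `κ a = Fin d` this is the space of order-`r` tensors over `ℝ^d`. -/
abbrev RealTensor {ι : Type} (κ : ι → Type) : Type := (∀ a, κ a) → ℝ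

namespace RealTensor

/-- The value `A(x) = ∑ A_{i} ∏ₐ (xₐ)_{iₐ}` of the multilinear form determined by `A`. -/
noncomputable def eval {ι : Type} [Fintype ι] [DecidableEq ι] {κ : ι → Type}
    [∀ a, Fintype (κ a)] (A : RealTensor κ) (x : ∀ a, EuclideanSpace ℝ (κ a)) : ℝ :=
  ∑ i : (∀ a, κ a), A i * ∏ a, x a (i a)

/-- The `ℓ₂` injective norm: the supremum of `A(x)` over all families `x` of vectors in the
Euclidean unit balls. -/
noncomputable def injectiveNorm {ι : Type} [Fintype ι] [DecidableEq ι] {κ : ι → Type}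
    [∀ a, Fintype (κ a)] (A : RealTensor κ) : ℝ :=
  sSup {v : ℝ | ∃ x : ∀ a, EuclideanSpace ℝ (κ a), (∀ a, ‖x a‖ ≤ 1) ∧ v = A.eval x}

/-- The tensor `A^P`: the modes are the blocks `I` of the partition `P`, and the index of the
block `I` is a tuple `(i_t)_{t ∈ I}` of original indices, so that the `I`-th factor
has dimension `d ^ |I|`. -/
def regroup {r d : ℕ} (A : RealTensor (fun _ : Fin r => Fin d))
    (P : Finpartition (Finset.univ : Finset (Fin r))) :
    RealTensor (fun I : {I : Finset (Fin r) // I ∈ P.parts} => (I.1 → Fin d)) :=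
  fun j => A fun t =>
    j ⟨P.part t, P.part_mem.2 (Finset.mem_univ t)⟩ ⟨t, P.mem_part (Finset.mem_univ t)⟩

/-- The decoupled chaos `∑ A_{i_1 … i_r} ∏ₜ (g_t)_{i_t}` built from random vectors `g_t`. -/
noncomputable def chaos {r d : ℕ} {Ω : Type*} (A : RealTensor (fun _ : Fin r => Fin d))
    (g : Fin r → Ω → EuclideanSpace ℝ (Fin d)) (ω : Ω) : ℝ :=
  ∑ i : Fin r → Fin d, A i * ∏ t, g t ω (i t)

end RealTensor

open scoped ENNReal

set_option linter.unusedSectionVars false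

/-! The Gaussian vectors are integrated out one at a time. At an intermediate stage there is a
family `B` of disjoint blocks of modes; each block is contracted with a vector of a unit ball, the
remaining modes with Gaussians, and `blockNorm` is the supremum over the unit balls. Integrating out
`g_t` means bounding the `p`-th moment of `sup_x ⟨u(x), g_t⟩`, where `u` is multilinear in `x`.

No chaining is needed. For fixed `h`, the variable `exp(l⟨u(σh), g⟩ - l²|u(σh)|²/2)` has mean 1 in
the Gaussian `g`, so its average over a Gaussian `h` also has mean 1, and that average does not
depend on `x`. Translating `h` by `x/σ` (Cameron–Martin) and applying Jensen bounds it below by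
`exp(l⟨u(x), g⟩ - (l²/2) E|u(x+σh)|² - |x|²/(2σ²))`. One random variable thus controls every `x` at
once (`exp_le_smoothedMoment`).

Expanding, `E|u(x+σh)|² = ∑_S σ^(2|S|) N_S(x)`, where `N_S` is the squared Euclidean norm of the
tensor left when the blocks of `S ⊆ B` stay uncontracted. By duality `√N_S` is at most the block
norm with `t` and all of `S` merged into one block (`ofReal_sqrt_partialSqNorm_le_blockNorm`). With
`σ² = 1/p` a step costs a constant times `√p · p^(-|S|/2)`, and merging changes the number of blocks
by `1 - |S|`, so the weights `p^(|B|/2)` are exactly preserved (`blockMoment_le_sum_mergeBlocks`).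
After `r` steps from `B = ∅` the blocks form a partition, no Gaussian is left, and the injective
norms appear. -/

/-- The standard Gaussian measure on `K → ℝ`. -/
noncomputable abbrev gaussianPi (K : Type*) [Fintype K] : Measure (K → ℝ) :=
  Measure.pi fun _ => gaussianReal 0 1

/-- The product, over `a : ι`, of the standard Gaussian measures on `κ a → ℝ`. -/
noncomputable abbrev gaussianPiPi {ι : Type*} [Fintype ι] (κ : ι → Type*) [∀ a, Fintype (κ a)] :
    Measure (∀ a, κ a → ℝ) :=
  Measure.pi fun a => gaussianPi (κ a)

/-! ### Translates of Gaussian measures, and Jensen's inequality for the exponential. -/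

theorem pi_withDensity {ι : Type*} [Fintype ι] {X : ι → Type*} [∀ a, MeasurableSpace (X a)]
    (μ : ∀ a, Measure (X a)) [∀ a, IsProbabilityMeasure (μ a)] (ρ : ∀ a, X a → ℝ≥0∞)
    (hρ : ∀ a, Measurable (ρ a)) [∀ a, SigmaFinite ((μ a).withDensity (ρ a))] :
    Measure.pi (fun a => (μ a).withDensity (ρ a)) =
      (Measure.pi μ).withDensity fun x => ∏ a, ρ a (x a) := by
  classical
  refine Measure.pi_eq fun s hs => ?_
  rw [withDensity_apply _ (MeasurableSet.univ_pi hs), ← lintegral_indicator (MeasurableSet.univ_pi hs)]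
  have h1 : ∀ x : ∀ a, X a, (Set.univ.pi s).indicator (fun x => ∏ a, ρ a (x a)) x =
      ∏ a, (s a).indicator (ρ a) (x a) := by
    intro x
    by_cases hx : x ∈ Set.univ.pi s
    · rw [Set.indicator_of_mem hx]
      exact Finset.prod_congr rfl fun a _ => (Set.indicator_of_mem (hx a trivial) _).symm
    · rw [Set.indicator_of_notMem hx]
      simp only [Set.mem_pi, Set.mem_univ, true_imp_iff, not_forall] at hx
      obtain ⟨a, ha⟩ := hx
      exact (Finset.prod_eq_zero (Finset.mem_univ a) (Set.indicator_of_notMem ha _)).symm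
  simp_rw [h1]
  have hm : ∀ a, Measurable ((s a).indicator (ρ a)) := fun a => (hρ a).indicator (hs a)
  have hind := iIndepFun_pi (μ := μ) (X := fun a => (s a).indicator (ρ a))
    fun a => (hm a).aemeasurable
  rw [lintegral_prod_eq_prod_lintegral_of_indepFun Finset.univ _ hind
    fun a => (hm a).comp (measurable_pi_apply a)]
  refine Finset.prod_congr rfl fun a _ => ?_
  rw [withDensity_apply _ (hs a), ← lintegral_indicator (hs a)]
  exact (measurePreserving_eval μ a).lintegral_comp (hm a)

theorem gaussianReal_map_add_eq_withDensity (z : ℝ) :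
    (gaussianReal 0 1).map (fun y => y + z) =
      (gaussianReal 0 1).withDensity fun y => ENNReal.ofReal (Real.exp (z * y - z ^ 2 / 2)) := by
  rw [gaussianReal_map_add_const, gaussianReal_of_var_ne_zero _ one_ne_zero,
    gaussianReal_of_var_ne_zero _ one_ne_zero,
    ← withDensity_mul _ (measurable_gaussianPDF _ _) (by fun_prop)]
  congr 1
  ext y
  rw [Pi.mul_apply, gaussianPDF, gaussianPDF, ← ENNReal.ofReal_mul (gaussianPDFReal_nonneg _ _ _)]
  congr 1
  rw [gaussianPDFReal, gaussianPDFReal, mul_assoc _ (Real.exp _) (Real.exp _), ← Real.exp_add]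
  congr 2
  simp only [NNReal.coe_one]
  ring

theorem gaussianPi_map_add_eq_withDensity {K : Type*} [Fintype K] (z : K → ℝ) :
    (gaussianPi K).map (fun y => y + z) =
      (gaussianPi K).withDensity fun y =>
        ENNReal.ofReal (Real.exp (∑ k, (z k * y k - z k ^ 2 / 2))) := by
  have h : (fun y : K → ℝ => y + z) = fun y k => y k + z k := rfl
  have hσ : ∀ k, IsProbabilityMeasure ((gaussianReal 0 1).map (fun y => y + z k)) := fun k =>
    Measure.isProbabilityMeasure_map (by fun_prop)
  rw [h, Measure.pi_map_pi (f := fun k y => y + z k) (fun k => by fun_prop)]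
  have hσ' : ∀ k, SigmaFinite ((gaussianReal 0 1).withDensity
      fun y => ENNReal.ofReal (Real.exp (z k * y - z k ^ 2 / 2))) := fun k => by
    rw [← gaussianReal_map_add_eq_withDensity]; infer_instance
  simp_rw [gaussianReal_map_add_eq_withDensity]
  rw [pi_withDensity _ _ fun k => by fun_prop]
  congr 1
  ext y
  rw [Real.exp_sum, ENNReal.ofReal_prod_of_nonneg fun _ _ => (Real.exp_pos _).le]

section GaussianPiPi

variable {ι : Type*} [Fintype ι] {κ : ι → Type*} [∀ a, Fintype (κ a)]

/-- The Cameron–Martin formula. -/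
theorem gaussianPiPi_map_add_eq_withDensity (z : ∀ a, κ a → ℝ) :
    (gaussianPiPi κ).map (fun y => y + z) =
      (gaussianPiPi κ).withDensity fun y =>
        ENNReal.ofReal (Real.exp (∑ a, ∑ k, (z a k * y a k - z a k ^ 2 / 2))) := by
  have h : (fun y : ∀ a, κ a → ℝ => y + z) = fun y a => y a + z a := rfl
  have hσ : ∀ a, IsProbabilityMeasure ((gaussianPi (κ a)).map (fun y => y + z a)) := fun k =>
    Measure.isProbabilityMeasure_map (by fun_prop)
  rw [h, gaussianPiPi, Measure.pi_map_pi (f := fun a y => y + z a) (fun k => by fun_prop)]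
  have hσ' : ∀ a, SigmaFinite ((gaussianPi (κ a)).withDensity
      fun y => ENNReal.ofReal (Real.exp (∑ k, (z a k * y k - z a k ^ 2 / 2)))) := fun k => by
    rw [← gaussianPi_map_add_eq_withDensity]; infer_instance
  simp_rw [gaussianPi_map_add_eq_withDensity]
  rw [pi_withDensity _ _ fun k => by fun_prop]
  congr 1
  ext y
  rw [Real.exp_sum, ENNReal.ofReal_prod_of_nonneg fun _ _ => (Real.exp_pos _).le]

/-- The integrand is the density of the translate by `u`, which is a probability measure. -/
theorem lintegral_exp_gaussianPi {K : Type*} [Fintype K] (u : K → ℝ) :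
    ∫⁻ y, ENNReal.ofReal (Real.exp (∑ k, u k * y k - (∑ k, u k ^ 2) / 2)) ∂gaussianPi K = 1 := by
  have hp : IsProbabilityMeasure ((gaussianPi K).map (fun y => y + u)) :=
    Measure.isProbabilityMeasure_map (by fun_prop)
  have h := hp.measure_univ
  rw [gaussianPi_map_add_eq_withDensity, withDensity_apply _ MeasurableSet.univ,
    setLIntegral_univ] at h
  simpa only [Finset.sum_sub_distrib, ← Finset.sum_div] using h

/-- Jensen through the tangent line of `exp` at the mean; the exponential need not be integrable, as
the right side may be `∞`. -/
theorem ofReal_exp_integral_le_lintegral {Ω : Type*} [MeasurableSpace Ω] (μ : Measure Ω)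
    [IsProbabilityMeasure μ] {q : Ω → ℝ} (hq : Integrable q μ) :
    ENNReal.ofReal (Real.exp (∫ ω, q ω ∂μ)) ≤ ∫⁻ ω, ENNReal.ofReal (Real.exp (q ω)) ∂μ := by
  set c := ∫ ω, q ω ∂μ
  have hi : Integrable (fun ω => Real.exp c * (1 + q ω - c)) μ :=
    (((integrable_const 1).add hq).sub (integrable_const c)).const_mul _
  have h1 : ∫ ω, Real.exp c * (1 + q ω - c) ∂μ = Real.exp c := by
    have h1q : Integrable (fun ω => 1 + q ω) μ := (integrable_const 1).add hq
    rw [integral_const_mul, integral_sub h1q (integrable_const c),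
      integral_add (integrable_const 1) hq]
    simp [c]
  have h2 : ∀ ω, Real.exp c * (1 + q ω - c) ≤ Real.exp (q ω) := fun ω => by
    have := Real.add_one_le_exp (q ω - c)
    have h3 : Real.exp (q ω) = Real.exp c * Real.exp (q ω - c) := by
      rw [← Real.exp_add]; ring_nf
    rw [h3]
    exact mul_le_mul_of_nonneg_left (by linarith) (Real.exp_pos _).le
  calc ENNReal.ofReal (Real.exp c)
      = ENNReal.ofReal (∫ ω, Real.exp c * (1 + q ω - c) ∂μ) := by rw [h1]
    _ ≤ ENNReal.ofReal (∫ ω, max (Real.exp c * (1 + q ω - c)) 0 ∂μ) :=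
        ENNReal.ofReal_le_ofReal (integral_mono hi hi.pos_part fun ω => le_max_left _ _)
    _ = ∫⁻ ω, ENNReal.ofReal (max (Real.exp c * (1 + q ω - c)) 0) ∂μ :=
        ofReal_integral_eq_lintegral_ofReal hi.pos_part
          (Filter.Eventually.of_forall fun ω => le_max_right _ _)
    _ ≤ _ := lintegral_mono fun ω =>
        ENNReal.ofReal_le_ofReal (max_le (h2 ω) (Real.exp_pos _).le)

theorem integrable_prod_gaussianPiPi (s : Finset ι) (f : ∀ a, (κ a → ℝ) → ℝ)
    (hf : ∀ a, Integrable (f a) (gaussianPi (κ a))) :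
    Integrable (fun h : ∀ a, κ a → ℝ => ∏ a ∈ s, f a (h a)) (gaussianPiPi κ) := by
  classical
  have h1 : (fun h : ∀ a, κ a → ℝ => ∏ a ∈ s, f a (h a)) =
      fun h => ∏ a, (if a ∈ s then f a else 1) (h a) := by
    ext h
    rw [← Finset.prod_subset (Finset.subset_univ s) fun a _ ha => by simp [ha]]
    exact Finset.prod_congr rfl fun a ha => by rw [if_pos ha]
  rw [h1]
  refine Integrable.fintype_prod_dep fun a => ?_
  split_ifs
  · exact hf a
  · exact integrable_const 1

theorem integral_prod_gaussianPiPi (s : Finset ι) (f : ∀ a, (κ a → ℝ) → ℝ) :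
    ∫ h : ∀ a, κ a → ℝ, ∏ a ∈ s, f a (h a) ∂(gaussianPiPi κ) =
      ∏ a ∈ s, ∫ y, f a y ∂(gaussianPi (κ a)) := by
  classical
  have h1 : ∀ F : ι → ℝ, ∏ a ∈ s, F a = ∏ a, if a ∈ s then F a else 1 := fun F => by
    simp [Finset.prod_ite_mem]
  have h2 : ∀ h : ∀ a, κ a → ℝ, ∏ a ∈ s, f a (h a) =
      ∏ a, (if a ∈ s then f a else fun _ => 1) (h a) := fun h => by
    rw [h1]
    exact Finset.prod_congr rfl fun a _ => by split_ifs <;> rfl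
  simp_rw [h2]
  rw [integral_fintype_prod_eq_prod, h1]
  exact Finset.prod_congr rfl fun a _ => by split_ifs <;> simp

end GaussianPiPi

/-! ### First and second moments of affine functions of Gaussian coordinates. -/

section GaussianPi

variable {K : Type*} [Fintype K]

theorem memLp_eval_gaussianPi (k : K) : MemLp (fun y : K → ℝ => y k) 2 (gaussianPi K) :=
  (memLp_id_gaussianReal 2).comp_measurePreserving
    (measurePreserving_eval (fun _ : K => gaussianReal 0 1) k)

theorem integral_eval_gaussianPi (k : K) : ∫ y : K → ℝ, y k ∂(gaussianPi K) = 0 := by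
  have h := (measurePreserving_eval (fun _ : K => gaussianReal 0 1) k)
  have := integral_map (μ := gaussianPi K) (φ := fun y => y k) h.measurable.aemeasurable
    (f := fun t : ℝ => t) (by fun_prop)
  rw [← this]
  have h2 : (gaussianPi K).map (fun y => y k) = gaussianReal 0 1 := h.map_eq
  rw [h2, integral_id_gaussianReal]

theorem integral_eval_mul_eval_gaussianPi [DecidableEq K] (k l : K) :
    ∫ y : K → ℝ, y k * y l ∂(gaussianPi K) = if k = l then 1 else 0 := by
  split_ifs with h
  · subst h
    have h := (measurePreserving_eval (fun _ : K => gaussianReal 0 1) k)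
    have := integral_map (μ := gaussianPi K) (φ := fun y => y k) h.measurable.aemeasurable
      (f := fun t : ℝ => t * t) (by fun_prop)
    rw [← this]
    have h2 : (gaussianPi K).map (fun y => y k) = gaussianReal 0 1 := h.map_eq
    rw [h2]
    have h3 := variance_fun_id_gaussianReal (μ := 0) (v := 1)
    rw [variance_of_integral_eq_zero (by fun_prop) integral_id_gaussianReal] at h3
    simpa [sq] using h3
  · have hi : iIndepFun (fun k (y : K → ℝ) => y k) (gaussianPi K) :=
      iIndepFun_pi (μ := fun _ : K => gaussianReal 0 1) (X := fun _ y => y)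
        fun _ => aemeasurable_id
    have := (hi.indepFun h).integral_fun_mul_eq_mul_integral
      (memLp_eval_gaussianPi k).aestronglyMeasurable (memLp_eval_gaussianPi l).aestronglyMeasurable
    rw [this, integral_eval_gaussianPi, zero_mul]

theorem integrable_affine_gaussianPi (σ c : ℝ) (k : K) :
    Integrable (fun y : K → ℝ => c + σ * y k) (gaussianPi K) :=
  (integrable_const c).add (((memLp_eval_gaussianPi k).integrable one_le_two).const_mul σ)

theorem integral_affine_gaussianPi (σ c : ℝ) (k : K) :
    ∫ y : K → ℝ, (c + σ * y k) ∂(gaussianPi K) = c := by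
  rw [integral_add (integrable_const c)
    (((memLp_eval_gaussianPi k).integrable one_le_two).const_mul σ), integral_const_mul,
    integral_eval_gaussianPi]
  simp

theorem integrable_affine_mul_affine_gaussianPi (σ c c' : ℝ) (k l : K) :
    Integrable (fun y : K → ℝ => (c + σ * y k) * (c' + σ * y l)) (gaussianPi K) :=
  ((memLp_const c).add ((memLp_eval_gaussianPi k).const_mul σ)).integrable_mul
    ((memLp_const c').add ((memLp_eval_gaussianPi l).const_mul σ))

theorem integral_affine_mul_affine_gaussianPi [DecidableEq K] (σ c c' : ℝ) (k l : K) :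
    ∫ y : K → ℝ, (c + σ * y k) * (c' + σ * y l) ∂(gaussianPi K) =
      c * c' + if k = l then σ ^ 2 else 0 := by
  have hk := (memLp_eval_gaussianPi k).integrable one_le_two
  have hl := (memLp_eval_gaussianPi l).integrable one_le_two
  have hkl : Integrable (fun y : K → ℝ => y k * y l) (gaussianPi K) :=
    (memLp_eval_gaussianPi k).integrable_mul (memLp_eval_gaussianPi l)
  have h : ∀ y : K → ℝ, (c + σ * y k) * (c' + σ * y l) =
      c * c' + c * σ * y l + c' * σ * y k + σ ^ 2 * (y k * y l) := fun y => by ring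
  simp_rw [h]
  have h1 : Integrable (fun y : K → ℝ => c * c' + c * σ * y l) (gaussianPi K) :=
    (integrable_const _).add (hl.const_mul _)
  have h2 : Integrable (fun y : K → ℝ => c * c' + c * σ * y l + c' * σ * y k) (gaussianPi K) :=
    h1.add (hk.const_mul _)
  rw [integral_add h2 (hkl.const_mul _), integral_add h1 (hk.const_mul _),
    integral_add (integrable_const _) (hl.const_mul _), integral_const, integral_const_mul,
    integral_const_mul, integral_eval_gaussianPi, integral_eval_gaussianPi, integral_const_mul,
    integral_eval_mul_eval_gaussianPi]
  simp

end GaussianPi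

/-! ### The variational lower bound for exponential moments. -/

section GaussianTranslate

variable {ι : Type*} [Fintype ι] [DecidableEq ι] {κ : ι → Type*} [∀ a, Fintype (κ a)]

theorem integrable_eval_gaussianPiPi (a : ι) (k : κ a) :
    Integrable (fun h : ∀ a, κ a → ℝ => h a k) (gaussianPiPi κ) := by
  -- A single coordinate is a product over `{a}`; the cast only makes the factor defined for every
  -- `b`.
  have := integrable_prod_gaussianPiPi (κ := κ) {a} (fun b y => if h : b = a then y (h ▸ k) else 0)
    fun b => by
      by_cases h : b = a
      · subst h; simpa using (memLp_eval_gaussianPi k).integrable one_le_two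
      · simp [h]
  simpa using this

theorem integral_eval_gaussianPiPi (a : ι) (k : κ a) :
    ∫ h : ∀ a, κ a → ℝ, h a k ∂(gaussianPiPi κ) = 0 := by
  have := integral_prod_gaussianPiPi (κ := κ) {a} (fun b y => if h : b = a then y (h ▸ k) else 0)
  simpa [integral_eval_gaussianPi] using this

/-- The variational (PAC-Bayes) lower bound for an exponential moment under a Gaussian measure,
tested against the translate of that measure by `z`. -/
theorem ofReal_exp_integral_add_le_lintegral (z : ∀ a, κ a → ℝ) {q : (∀ a, κ a → ℝ) → ℝ}
    (hqm : Measurable q) (hq : Integrable (fun h => q (h + z)) (gaussianPiPi κ)) :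
    ENNReal.ofReal (Real.exp (∫ h, q (h + z) ∂(gaussianPiPi κ) - (∑ a, ∑ k, z a k ^ 2) / 2)) ≤
      ∫⁻ h, ENNReal.ofReal (Real.exp (q h)) ∂(gaussianPiPi κ) := by
  -- The log-density of the translate. Its mean under the translate, `|z|²/2`, is the relative
  -- entropy paid in the bound.
  let L : (∀ a, κ a → ℝ) → ℝ := fun h => ∑ a, ∑ k, (z a k * h a k - z a k ^ 2 / 2)
  have hLm : Measurable L := by fun_prop
  have hl : Integrable (fun h : ∀ a, κ a → ℝ => ∑ a, ∑ k, z a k * h a k) (gaussianPiPi κ) :=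
    integrable_finsetSum _ fun a _ => integrable_finsetSum _ fun k _ => (integrable_eval_gaussianPiPi a k).const_mul _
  have hl0 : ∫ h : ∀ a, κ a → ℝ, ∑ a, ∑ k, z a k * h a k ∂(gaussianPiPi κ) = 0 := by
    rw [integral_finsetSum _ fun a _ =>
      integrable_finsetSum _ fun k _ => (integrable_eval_gaussianPiPi a k).const_mul _]
    refine Finset.sum_eq_zero fun a _ => ?_
    rw [integral_finsetSum _ fun k _ => (integrable_eval_gaussianPiPi a k).const_mul _]
    exact Finset.sum_eq_zero fun k _ => by rw [integral_const_mul, integral_eval_gaussianPiPi, mul_zero]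
  have hL : ∀ h, L (h + z) = ∑ a, ∑ k, z a k * h a k + (∑ a, ∑ k, z a k ^ 2) / 2 := fun h => by
    simp only [L, Finset.sum_div, ← Finset.sum_add_distrib, Pi.add_apply]
    exact Finset.sum_congr rfl fun a _ => Finset.sum_congr rfl fun k _ => by ring
  have key : ∫⁻ h, ENNReal.ofReal (Real.exp (q h)) ∂(gaussianPiPi κ) =
      ∫⁻ h, ENNReal.ofReal (Real.exp (q (h + z) - L (h + z))) ∂(gaussianPiPi κ) := by
    rw [← lintegral_map (f := fun h => ENNReal.ofReal (Real.exp (q h - L h)))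
      (g := fun h => h + z) (by fun_prop) (by fun_prop), gaussianPiPi_map_add_eq_withDensity,
      lintegral_withDensity_eq_lintegral_mul _ (by fun_prop) (by fun_prop)]
    refine lintegral_congr fun h => ?_
    rw [Pi.mul_apply, ← ENNReal.ofReal_mul (Real.exp_pos _).le, ← Real.exp_add]
    congr 2
    simp only [L]
    ring
  rw [key]
  have hi : Integrable (fun h => q (h + z) - L (h + z)) (gaussianPiPi κ) := by
    simp_rw [hL]
    exact hq.sub (hl.add (integrable_const _))
  refine le_trans (le_of_eq ?_) (ofReal_exp_integral_le_lintegral _ hi)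
  congr 2
  simp_rw [hL]
  have hl' : Integrable (fun h : ∀ a, κ a → ℝ => ∑ a, ∑ k, z a k * h a k +
      (∑ a, ∑ k, z a k ^ 2) / 2) (gaussianPiPi κ) := hl.add (integrable_const _)
  rw [integral_sub hq hl', integral_add hl (integrable_const _), hl0]
  simp

end GaussianTranslate

/-! ### Gaussian smoothing of a multilinear form and the moment of its supremum. -/

section SmoothedForm

variable {ι J D : Type*} {κ : ι → Type*}

/-- The vector in `ℝ^D` obtained by contracting the modes in `s` of a tensor with the vectors `x`.
The entries of the tensor are listed by `J`, with values `w`; the index of the entry `j`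
in the mode `a` is `e a j`, and its index in the remaining mode is `τ j`. -/
noncomputable def contraction [Fintype J] [DecidableEq D] (e : ∀ a, J → κ a) (τ : J → D)
    (s : Finset ι) (w : J → ℝ) (x : ∀ a, κ a → ℝ) (k : D) : ℝ :=
  ∑ j, if τ j = k then w j * ∏ a ∈ s, x a (e a j) else 0

/-- The sum of the squares of the entries of the tensor that remains when the modes in `s \ S` are
contracted with `x`. -/
noncomputable def partialSqNorm [Fintype J] [DecidableEq D] [DecidableEq ι]
    [∀ a, DecidableEq (κ a)] (e : ∀ a, J → κ a) (τ : J → D)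
    (s : Finset ι) (w : J → ℝ) (S : Finset ι) (x : ∀ a, κ a → ℝ) : ℝ :=
  ∑ i, ∑ j, if τ i = τ j ∧ ∀ a ∈ S, e a i = e a j then
    (w i * ∏ a ∈ s \ S, x a (e a i)) * (w j * ∏ a ∈ s \ S, x a (e a j)) else 0

theorem sum_contraction_mul [Fintype J] [Fintype D] [DecidableEq D] (e : ∀ a, J → κ a) (τ : J → D)
    (s : Finset ι) (w : J → ℝ) (x : ∀ a, κ a → ℝ) (g : D → ℝ) :
    ∑ k, contraction e τ s w x k * g k = ∑ j, w j * (∏ a ∈ s, x a (e a j)) * g (τ j) := by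
  simp_rw [contraction, Finset.sum_mul]
  rw [Finset.sum_comm]
  refine Finset.sum_congr rfl fun j _ => ?_
  simp [ite_mul]

theorem sum_contraction_sq [Fintype J] [Fintype D] [DecidableEq D] (e : ∀ a, J → κ a) (τ : J → D)
    (s : Finset ι) (w : J → ℝ) (x : ∀ a, κ a → ℝ) :
    ∑ k, contraction e τ s w x k ^ 2 = ∑ i, ∑ j, if τ i = τ j then
      w i * w j * ∏ a ∈ s, x a (e a i) * x a (e a j) else 0 := by
  simp_rw [sq]
  rw [sum_contraction_mul]
  refine Finset.sum_congr rfl fun i _ => ?_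
  rw [contraction, Finset.mul_sum]
  refine Finset.sum_congr rfl fun j _ => ?_
  by_cases h : τ i = τ j
  · rw [if_pos h, if_pos h.symm, Finset.prod_mul_distrib]; ring
  · rw [if_neg h, if_neg (Ne.symm h), mul_zero]

@[fun_prop]
theorem measurable_contraction [Fintype J] [DecidableEq D] (e : ∀ a, J → κ a) (τ : J → D)
    (s : Finset ι) (w : J → ℝ) (k : D) : Measurable fun x => contraction e τ s w x k := by
  unfold contraction
  refine Finset.measurable_sum _ fun j _ => ?_
  split_ifs
  · exact (Finset.measurable_prod _ fun a _ => by fun_prop).const_mul _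
  · exact measurable_const

variable [Fintype ι] [DecidableEq ι] [∀ a, Fintype (κ a)] [∀ a, DecidableEq (κ a)]
  [Fintype J] [Fintype D] [DecidableEq D]
  (e : ∀ a, J → κ a) (τ : J → D) (s : Finset ι) (w : J → ℝ)

theorem integrable_contraction_gaussianPiPi (x : ∀ a, κ a → ℝ) (σ : ℝ) (k : D) :
    Integrable (fun h : ∀ a, κ a → ℝ => contraction e τ s w (x + σ • h) k) (gaussianPiPi κ) := by
  unfold contraction
  refine integrable_finsetSum _ fun j _ => ?_
  split_ifs
  · exact (integrable_prod_gaussianPiPi s (fun a y => x a (e a j) + σ * y (e a j))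
      fun a => integrable_affine_gaussianPi _ _ _).const_mul _
  · exact integrable_zero _ _ _

theorem integral_contraction_gaussianPiPi (x : ∀ a, κ a → ℝ) (σ : ℝ) (k : D) :
    ∫ h : ∀ a, κ a → ℝ, contraction e τ s w (x + σ • h) k ∂(gaussianPiPi κ) =
      contraction e τ s w x k := by
  unfold contraction
  have hi : ∀ j, Integrable (fun h : ∀ a, κ a → ℝ => ∏ a ∈ s, (x + σ • h) a (e a j))
      (gaussianPiPi κ) := fun j =>
    integrable_prod_gaussianPiPi s (fun a y => x a (e a j) + σ * y (e a j))
      fun a => integrable_affine_gaussianPi _ _ _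
  rw [integral_finsetSum]
  · refine Finset.sum_congr rfl fun j _ => ?_
    split_ifs
    · rw [integral_const_mul]
      congr 1
      refine (integral_prod_gaussianPiPi s (fun a y => x a (e a j) + σ * y (e a j))).trans ?_
      exact Finset.prod_congr rfl fun a _ => integral_affine_gaussianPi _ _ _
    · exact integral_zero _ _
  · intro j _
    split_ifs
    · exact (hi j).const_mul _
    · exact integrable_zero _ _ _

theorem integrable_sum_contraction_sq_gaussianPiPi (x : ∀ a, κ a → ℝ) (σ : ℝ) :
    Integrable (fun h : ∀ a, κ a → ℝ => ∑ k, contraction e τ s w (x + σ • h) k ^ 2)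
      (gaussianPiPi κ) := by
  simp_rw [sum_contraction_sq]
  refine integrable_finsetSum _ fun i _ => integrable_finsetSum _ fun j _ => ?_
  split_ifs
  · exact (integrable_prod_gaussianPiPi s
      (fun a y => (x a (e a i) + σ * y (e a i)) * (x a (e a j) + σ * y (e a j)))
      fun a => integrable_affine_mul_affine_gaussianPi _ _ _ _ _).const_mul _
  · exact integrable_zero _ _ _

/-- By independence each pair of entries `i, j` contributes a product over `a ∈ s` of `x_a(i) x_a(j)
+ σ² 1{i_a = j_a}`; in its expansion, `S` is the set of modes where the second term is chosen. -/
theorem integral_sum_contraction_sq_gaussianPiPi (x : ∀ a, κ a → ℝ) (σ : ℝ) :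
    ∫ h : ∀ a, κ a → ℝ, ∑ k, contraction e τ s w (x + σ • h) k ^ 2 ∂(gaussianPiPi κ) =
      ∑ S ∈ s.powerset, (σ ^ 2) ^ S.card * partialSqNorm e τ s w S x := by
  have hi : ∀ i j, Integrable (fun h : ∀ a, κ a → ℝ => if τ i = τ j then
      w i * w j * ∏ a ∈ s, (x + σ • h) a (e a i) * (x + σ • h) a (e a j) else 0)
      (gaussianPiPi κ) := fun i j => by
    split_ifs
    · exact (integrable_prod_gaussianPiPi s
        (fun a y => (x a (e a i) + σ * y (e a i)) * (x a (e a j) + σ * y (e a j)))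
        fun a => integrable_affine_mul_affine_gaussianPi _ _ _ _ _).const_mul _
    · exact integrable_zero _ _ _
  have hval : ∀ i j, ∫ h : ∀ a, κ a → ℝ, (if τ i = τ j then
      w i * w j * ∏ a ∈ s, (x + σ • h) a (e a i) * (x + σ • h) a (e a j) else 0)
      ∂(gaussianPiPi κ) = ∑ S ∈ s.powerset, (σ ^ 2) ^ S.card *
        (if τ i = τ j ∧ ∀ a ∈ S, e a i = e a j then
          (w i * ∏ a ∈ s \ S, x a (e a i)) * (w j * ∏ a ∈ s \ S, x a (e a j)) else 0) := by
    intro i j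
    by_cases hτ : τ i = τ j
    · simp only [hτ, if_true, true_and]
      rw [integral_const_mul]
      have h1 := integral_prod_gaussianPiPi s
        (fun a y => (x a (e a i) + σ * y (e a i)) * (x a (e a j) + σ * y (e a j)))
      simp only [integral_affine_mul_affine_gaussianPi] at h1
      refine (congrArg (w i * w j * ·) h1).trans ?_
      simp_rw [add_comm (_ * _) (ite _ _ _)]
      rw [Finset.prod_add, Finset.mul_sum]
      refine Finset.sum_congr rfl fun S _ => ?_
      rw [Finset.prod_ite_zero]
      split_ifs
      · rw [Finset.prod_const, Finset.prod_mul_distrib]; ring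
      · simp
    · simp [hτ]
  simp_rw [sum_contraction_sq]
  rw [integral_finsetSum _ fun i _ => integrable_finsetSum _ fun j _ => hi i j]
  simp_rw [integral_finsetSum _ fun j _ => hi _ j, hval, partialSqNorm, Finset.mul_sum]
  rw [Finset.sum_comm (s := s.powerset)]
  refine Finset.sum_congr rfl fun i _ => ?_
  rw [Finset.sum_comm (s := s.powerset)]
  exact Finset.sum_congr rfl fun j _ => Finset.sum_congr rfl fun S _ => by congr

/-- The exponential moment, over the smoothing variables, of a self-normalized form. -/
noncomputable def smoothedMoment (σ l : ℝ) (g : D → ℝ) : ℝ≥0∞ :=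
  ∫⁻ h : ∀ a, κ a → ℝ, ENNReal.ofReal (Real.exp
    (∑ k, (l * contraction e τ s w (σ • h) k) * g k -
      (∑ k, (l * contraction e τ s w (σ • h) k) ^ 2) / 2)) ∂(gaussianPiPi κ)

theorem measurable_smoothedMoment (σ l : ℝ) : Measurable (smoothedMoment e τ s w σ l) := by
  unfold smoothedMoment
  refine Measurable.lintegral_prod_right' (f := fun gh : (D → ℝ) × (∀ a, κ a → ℝ) =>
    ENNReal.ofReal (Real.exp
    (∑ k, (l * contraction e τ s w (σ • gh.2) k) * gh.1 k -
      (∑ k, (l * contraction e τ s w (σ • gh.2) k) ^ 2) / 2))) ?_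
  have h : ∀ k, Measurable fun gh : (D → ℝ) × (∀ a, κ a → ℝ) =>
      contraction e τ s w (σ • gh.2) k := fun k =>
    (measurable_contraction e τ s w k).comp (measurable_snd.const_smul σ)
  fun_prop

/-- By Tonelli `g` can be integrated first; for fixed `h` the integrand is then a Cameron–Martin
density. -/
theorem lintegral_smoothedMoment (σ l : ℝ) :
    ∫⁻ g, smoothedMoment e τ s w σ l g ∂(gaussianPi D) = 1 := by
  have h : ∀ k, Measurable fun gh : (D → ℝ) × (∀ a, κ a → ℝ) =>
      contraction e τ s w (σ • gh.2) k := fun k =>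
    (measurable_contraction e τ s w k).comp (measurable_snd.const_smul σ)
  unfold smoothedMoment
  rw [lintegral_lintegral_swap (by unfold Function.uncurry; fun_prop)]
  simp_rw [lintegral_exp_gaussianPi]
  simp

/-- The variational bound with translation `x/σ`, which recentres `σh` at `x`. Multilinearity keeps
the linear term unchanged on average, and the entropy is at most `card ι / (2σ²)`. The smoothed
moment on the right is free of `x`. -/
theorem exp_le_smoothedMoment {σ : ℝ} (hσ : 0 < σ) (l : ℝ) (x : ∀ a, κ a → ℝ)
    (hx : ∀ a, ∑ k, x a k ^ 2 ≤ 1) {V : ℝ}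
    (hV : ∑ S ∈ s.powerset, (σ ^ 2) ^ S.card * partialSqNorm e τ s w S x ≤ V) (g : D → ℝ) :
    ENNReal.ofReal (Real.exp (l * ∑ k, contraction e τ s w x k * g k)) ≤
      ENNReal.ofReal (Real.exp (l ^ 2 * V / 2 + Fintype.card ι / (2 * σ ^ 2))) *
        smoothedMoment e τ s w σ l g := by
  let q : (∀ a, κ a → ℝ) → ℝ := fun h => ∑ k, (l * contraction e τ s w (σ • h) k) * g k -
      (∑ k, (l * contraction e τ s w (σ • h) k) ^ 2) / 2
  have hm : ∀ k, Measurable fun h : (∀ a, κ a → ℝ) =>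
      contraction e τ s w (σ • h) k := fun k =>
    (measurable_contraction e τ s w k).comp (measurable_id.const_smul σ)
  have hqm : Measurable q := by fun_prop
  have hshift : ∀ h : ∀ a, κ a → ℝ, σ • (h + σ⁻¹ • x) = x + σ • h := fun h => by
    rw [smul_add, smul_inv_smul₀ hσ.ne', add_comm]
  have hq : ∀ h, q (h + σ⁻¹ • x) = ∑ k, (l * g k) * contraction e τ s w (x + σ • h) k -
      l ^ 2 / 2 * ∑ k, contraction e τ s w (x + σ • h) k ^ 2 := fun h => by
    simp only [q, hshift, Finset.mul_sum, Finset.sum_div]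
    congr 1 <;> exact Finset.sum_congr rfl fun k _ => by ring
  have hi1 : Integrable (fun h => ∑ k, (l * g k) * contraction e τ s w (x + σ • h) k)
      (gaussianPiPi κ) := integrable_finsetSum _ fun k _ =>
    (integrable_contraction_gaussianPiPi e τ s w x σ k).const_mul _
  have hi2 := (integrable_sum_contraction_sq_gaussianPiPi e τ s w x σ).const_mul (l ^ 2 / 2)
  have hqi : Integrable (fun h => q (h + σ⁻¹ • x)) (gaussianPiPi κ) := by
    simp_rw [hq]; exact hi1.sub hi2
  have hint : ∫ h, q (h + σ⁻¹ • x) ∂(gaussianPiPi κ) =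
      l * ∑ k, contraction e τ s w x k * g k -
        l ^ 2 / 2 * ∑ S ∈ s.powerset, (σ ^ 2) ^ S.card * partialSqNorm e τ s w S x := by
    simp_rw [hq]
    rw [integral_sub hi1 hi2, integral_const_mul, integral_sum_contraction_sq_gaussianPiPi,
      integral_finsetSum _ fun k _ =>
        (integrable_contraction_gaussianPiPi e τ s w x σ k).const_mul _]
    simp_rw [integral_const_mul, integral_contraction_gaussianPiPi]
    rw [Finset.mul_sum Finset.univ _ l]
    congr 1
    exact Finset.sum_congr rfl fun k _ => by ring
  have h1 := ofReal_exp_integral_add_le_lintegral (σ⁻¹ • x) hqm hqi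
  rw [hint] at h1
  have h2 : ∑ a, ∑ k, (σ⁻¹ • x) a k ^ 2 ≤ Fintype.card ι / σ ^ 2 := by
    have : ∑ a, ∑ k, (σ⁻¹ • x) a k ^ 2 = (∑ a, ∑ k, x a k ^ 2) / σ ^ 2 := by
      simp only [Finset.sum_div]
      exact Finset.sum_congr rfl fun a _ => Finset.sum_congr rfl fun k _ => by
        simp only [Pi.smul_apply, smul_eq_mul]; field_simp
    rw [this]
    refine div_le_div_of_nonneg_right ?_ (sq_nonneg σ)
    calc ∑ a, ∑ k, x a k ^ 2 ≤ ∑ _a : ι, (1 : ℝ) := Finset.sum_le_sum fun a _ => hx a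
      _ = Fintype.card ι := by simp
  have h3 : (Fintype.card ι : ℝ) / (2 * σ ^ 2) = Fintype.card ι / σ ^ 2 / 2 := by
    field_simp
  have h4 := mul_le_mul_of_nonneg_left hV (sq_nonneg l)
  refine le_trans ?_ (mul_le_mul_right h1 _)
  rw [← ENNReal.ofReal_mul (Real.exp_pos _).le, ← Real.exp_add]
  refine ENNReal.ofReal_le_ofReal (Real.exp_le_exp.2 ?_)
  rw [h3]
  linarith

theorem rpow_le_rpow_mul_exp {t p : ℝ} (ht : 0 ≤ t) (hp : 0 < p) :
    t ^ p ≤ p ^ p * Real.exp t := by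
  have h1 : t / p ≤ Real.exp (t / p) := by linarith [Real.add_one_le_exp (t / p)]
  have h2 : (t / p) ^ p ≤ Real.exp (t / p) ^ p :=
    Real.rpow_le_rpow (div_nonneg ht hp.le) h1 hp.le
  rw [← Real.exp_mul, div_mul_cancel₀ _ hp.ne', Real.div_rpow ht hp.le,
    div_le_iff₀ (Real.rpow_pos_of_pos hp p)] at h2
  linarith

/-- The `p`-th moment of the supremum, over the unit balls, of a multilinear form with one Gaussian
argument. -/
theorem lintegral_iSup_contraction_rpow_le {p V : ℝ} (hp : 2 ≤ p) (hV0 : 0 < V)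
    (hV : ∀ x : ∀ a, κ a → ℝ, (∀ a, ∑ k, x a k ^ 2 ≤ 1) →
      ∑ S ∈ s.powerset, p⁻¹ ^ S.card * partialSqNorm e τ s w S x ≤ V) :
    ∫⁻ g, (⨆ (x : ∀ a, κ a → ℝ) (_ : ∀ a, ∑ k, x a k ^ 2 ≤ 1),
        ENNReal.ofReal |∑ k, contraction e τ s w x k * g k|) ^ p ∂(gaussianPi D) ≤
      ENNReal.ofReal (√p * Real.exp ((Fintype.card ι + 2) / 2) * √V) ^ p := by
  have hp0 : 0 < p := by linarith
  -- The choices `l²V = p` and `σ² = 1/p` make both the variance term and the entropy term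
  -- proportional to `p`, so they cost only a constant after the `p`-th root.
  set l := √p / √V with hl
  have hsV : 0 < √V := Real.sqrt_pos.2 hV0
  have hsp : 0 < √p := Real.sqrt_pos.2 hp0
  have hl0 : 0 < l := div_pos hsp hsV
  set σ := (√p)⁻¹ with hσ
  have hσ0 : 0 < σ := inv_pos.2 hsp
  have hσ2 : σ ^ 2 = p⁻¹ := by rw [hσ, inv_pow, Real.sq_sqrt hp0.le]
  have hl2 : l ^ 2 * V = p := by
    rw [hl, div_pow, Real.sq_sqrt hp0.le, Real.sq_sqrt hV0.le, div_mul_cancel₀ _ hV0.ne']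
  set c := Real.exp (p / 2 + Fintype.card ι / (2 * σ ^ 2)) with hc
  have hc0 : 0 < c := Real.exp_pos _
  have hK0 : 0 ≤ p ^ p / l ^ p * c := by positivity
  set R : (D → ℝ) → ℝ≥0∞ := fun g => ENNReal.ofReal (p ^ p / l ^ p * c) *
    (smoothedMoment e τ s w σ l g + smoothedMoment e τ s w σ (-l) g) with hR
  have hexp : ∀ x : ∀ a, κ a → ℝ, (∀ a, ∑ k, x a k ^ 2 ≤ 1) → ∀ g : D → ℝ,
      ENNReal.ofReal |∑ k, contraction e τ s w x k * g k| ^ p ≤ R g := by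
    intro x hx g
    set F := ∑ k, contraction e τ s w x k * g k with hF
    have hVx := hV x hx
    rw [← hσ2] at hVx
    have h1 := exp_le_smoothedMoment e τ s w hσ0 l x hx hVx g
    have h2 := exp_le_smoothedMoment e τ s w hσ0 (-l) x hx hVx g
    rw [neg_sq] at h2
    rw [hl2, ← hc] at h1 h2
    have h3 : |F| ^ p ≤ p ^ p / l ^ p * (Real.exp (l * F) + Real.exp (-l * F)) := by
      have h4 := rpow_le_rpow_mul_exp (mul_nonneg hl0.le (abs_nonneg F)) hp0
      rw [Real.mul_rpow hl0.le (abs_nonneg F)] at h4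
      have h5 : Real.exp (l * |F|) ≤ Real.exp (l * F) + Real.exp (-l * F) := by
        rcases abs_cases F with ⟨h, _⟩ | ⟨h, _⟩ <;> rw [h]
        · linarith [Real.exp_pos (-l * F)]
        · rw [mul_neg, ← neg_mul]; linarith [Real.exp_pos (l * F)]
      rw [div_mul_eq_mul_div, le_div_iff₀ (Real.rpow_pos_of_pos hl0 p), mul_comm]
      exact h4.trans (mul_le_mul_of_nonneg_left h5 (Real.rpow_nonneg hp0.le p))
    rw [ENNReal.ofReal_rpow_of_nonneg (abs_nonneg F) hp0.le]
    refine (ENNReal.ofReal_le_ofReal h3).trans ?_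
    rw [ENNReal.ofReal_mul (by positivity), ENNReal.ofReal_add (Real.exp_pos _).le
      (Real.exp_pos _).le, hR]
    dsimp only
    rw [ENNReal.ofReal_mul (by positivity), mul_assoc, mul_add (ENNReal.ofReal c)]
    exact mul_le_mul_right (add_le_add h1 h2) _
  -- Since `R g` does not involve `x`, the supremum costs nothing.
  have hsup : ∀ g, (⨆ (x : ∀ a, κ a → ℝ) (_ : ∀ a, ∑ k, x a k ^ 2 ≤ 1),
        ENNReal.ofReal |∑ k, contraction e τ s w x k * g k|) ^ p ≤ R g := by
    intro g
    rw [← ENNReal.le_rpow_inv_iff hp0]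
    exact iSup₂_le fun x hx => (ENNReal.le_rpow_inv_iff hp0).2 (hexp x hx g)
  refine (lintegral_mono hsup).trans ?_
  have hm := measurable_smoothedMoment e τ s w σ l
  have hm' := measurable_smoothedMoment e τ s w σ (-l)
  simp only [hR]
  have hmm : Measurable fun g => smoothedMoment e τ s w σ l g + smoothedMoment e τ s w σ (-l) g :=
    hm.add hm'
  rw [lintegral_const_mul _ hmm, lintegral_add_left hm, lintegral_smoothedMoment,
    lintegral_smoothedMoment, one_add_one_eq_two, ENNReal.ofReal_rpow_of_nonneg (by positivity) hp0.le,
    ← ENNReal.ofReal_ofNat 2, ← ENNReal.ofReal_mul hK0]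
  refine ENNReal.ofReal_le_ofReal ?_
  have h6 : p ^ p / l ^ p = (√p * √V) ^ p := by
    rw [← Real.div_rpow hp0.le hl0.le, hl]
    congr 1
    field_simp
    rw [Real.sq_sqrt hp0.le]
  have h7 : (√p * Real.exp ((Fintype.card ι + 2) / 2) * √V) ^ p =
      (√p * √V) ^ p * (Real.exp (p / 2 + Fintype.card ι * p / 2) * Real.exp (p / 2)) := by
    rw [show √p * Real.exp ((Fintype.card ι + 2) / 2) * √V =
      (√p * √V) * Real.exp ((Fintype.card ι + 2) / 2) by ring,
      Real.mul_rpow (by positivity) (Real.exp_pos _).le, ← Real.exp_mul, ← Real.exp_add]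
    congr 2
    ring
  have h8 : c = Real.exp (p / 2 + Fintype.card ι * p / 2) := by
    rw [hc, hσ2]
    congr 2
    field_simp
  -- The factor 2 comes from the two signs of `l`; `p ≥ 2` lets it be absorbed.
  have h9 : (2 : ℝ) ≤ Real.exp (p / 2) := by
    linarith [Real.add_one_le_exp (p / 2)]
  rw [h6, h7, h8, mul_assoc]
  gcongr

end SmoothedForm

namespace RealTensor

/-! ### Elementary properties of the injective norm. -/

section InjectiveNorm

variable {ι : Type} [Fintype ι] [DecidableEq ι] {κ : ι → Type} [∀ a, Fintype (κ a)]

theorem abs_eval_le_sum_abs (A : RealTensor κ) {x : ∀ a, EuclideanSpace ℝ (κ a)}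
    (hx : ∀ a, ‖x a‖ ≤ 1) : |A.eval x| ≤ ∑ i, |A i| := by
  refine (Finset.abs_sum_le_sum_abs _ _).trans (Finset.sum_le_sum fun i _ => ?_)
  rw [abs_mul, Finset.abs_prod]
  refine mul_le_of_le_one_right (abs_nonneg _) (Finset.prod_le_one (fun _ _ => abs_nonneg _) ?_)
  exact fun a _ => (PiLp.norm_apply_le (x a) (i a)).trans (hx a)

theorem eval_le_injectiveNorm (A : RealTensor κ) {x : ∀ a, EuclideanSpace ℝ (κ a)}
    (hx : ∀ a, ‖x a‖ ≤ 1) : A.eval x ≤ A.injectiveNorm := by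
  refine le_csSup ⟨∑ i, |A i|, ?_⟩ ⟨x, hx, rfl⟩
  rintro v ⟨y, hy, rfl⟩
  exact (le_abs_self _).trans (abs_eval_le_sum_abs A hy)

/-- A mode `a` must exist: a tensor with no modes is a scalar, and its norm as defined is that
scalar, possibly negative. -/
theorem injectiveNorm_nonneg (A : RealTensor κ) (a : ι) : 0 ≤ A.injectiveNorm := by
  have h := eval_le_injectiveNorm A (x := 0) fun a => by simp
  have h0 : A.eval 0 = 0 := Finset.sum_eq_zero fun i _ => by
    rw [Finset.prod_eq_zero (Finset.mem_univ a) (by simp), mul_zero]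
  rwa [h0] at h

/-- Flipping the sign of the vector in the one mode `a` flips the sign of the form. -/
theorem abs_eval_le_injectiveNorm (A : RealTensor κ) (a : ι)
    {x : ∀ a, EuclideanSpace ℝ (κ a)} (hx : ∀ a, ‖x a‖ ≤ 1) : |A.eval x| ≤ A.injectiveNorm := by
  refine abs_le'.2 ⟨eval_le_injectiveNorm A hx, ?_⟩
  have h : -A.eval x = A.eval fun b => (if b = a then (-1 : ℝ) else 1) • x b := by
    simp only [eval, PiLp.smul_apply, smul_eq_mul, Finset.prod_mul_distrib, Finset.prod_ite_eq',
      Finset.mem_univ, if_true]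
    rw [← Finset.sum_neg_distrib]
    exact Finset.sum_congr rfl fun i _ => by ring
  rw [h]
  refine eval_le_injectiveNorm A fun b => ?_
  split_ifs <;> simpa using hx b

end InjectiveNorm

/-! ### Block norms and the merging of blocks. -/

variable {r d : ℕ}

/-- The form obtained from `A` by contracting every block `I ∈ B` with the vector `x I`, whose
entries are indexed by tuples `(i_t)_{t ∈ I}`, and every mode `t` outside the blocks with `g t`. -/
noncomputable def blockForm (A : RealTensor (fun _ : Fin r => Fin d)) (B : Finset (Finset (Fin r)))
    (x : ∀ I : Finset (Fin r), (I → Fin d) → ℝ) (g : Fin r → Fin d → ℝ) : ℝ :=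
  ∑ i : Fin r → Fin d, (A i * ∏ t ∈ (B.biUnion id)ᶜ, g t (i t)) * ∏ I ∈ B, x I fun t => i t

/-- The supremum of `|blockForm A B x g|` over families `x` in the Euclidean unit balls. -/
noncomputable def blockNorm (A : RealTensor (fun _ : Fin r => Fin d))
    (B : Finset (Finset (Fin r))) (g : Fin r → Fin d → ℝ) : ℝ≥0∞ :=
  ⨆ (x : ∀ I : Finset (Fin r), (I → Fin d) → ℝ) (_ : ∀ I, ∑ k, x I k ^ 2 ≤ 1),
    ENNReal.ofReal |A.blockForm B x g|

/-- The blocks obtained from `B` by merging the blocks in `S` and the mode `t` into one block. -/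
def mergeBlocks (B S : Finset (Finset (Fin r))) (t : Fin r) : Finset (Finset (Fin r)) :=
  insert (insert t (S.biUnion id)) (B \ S)

section Merge

variable {B S : Finset (Finset (Fin r))} {t : Fin r}

theorem biUnion_mergeBlocks (hS : S ⊆ B) :
    (mergeBlocks B S t).biUnion id = insert t (B.biUnion id) := by
  ext s
  simp only [mergeBlocks, Finset.mem_biUnion, Finset.mem_insert, Finset.mem_sdiff, id]
  constructor
  · rintro ⟨I, rfl | ⟨hI, _⟩, hs⟩
    · simp only [Finset.mem_insert, Finset.mem_biUnion, id] at hs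
      rcases hs with rfl | ⟨I, hI, hs⟩
      · exact Or.inl rfl
      · exact Or.inr ⟨I, hS hI, hs⟩
    · exact Or.inr ⟨I, hI, hs⟩
  · rintro (rfl | ⟨I, hI, hs⟩)
    · exact ⟨_, Or.inl rfl, Finset.mem_insert_self _ _⟩
    · by_cases h : I ∈ S
      · exact ⟨_, Or.inl rfl, Finset.mem_insert_of_mem (Finset.mem_biUnion.2 ⟨I, h, hs⟩)⟩
      · exact ⟨I, Or.inr ⟨hI, h⟩, hs⟩

theorem compl_biUnion_mergeBlocks (hS : S ⊆ B) :
    ((mergeBlocks B S t).biUnion id)ᶜ = (B.biUnion id)ᶜ.erase t := by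
  rw [biUnion_mergeBlocks hS, Finset.compl_insert]

theorem merged_notMem_sdiff (ht : t ∉ B.biUnion id) : insert t (S.biUnion id) ∉ B \ S := fun h =>
  ht (Finset.mem_biUnion.2 ⟨_, (Finset.mem_sdiff.1 h).1, Finset.mem_insert_self _ _⟩)

/-- This count is what balances the powers of `√p` in `blockMoment_le_sum_mergeBlocks`. -/
theorem card_mergeBlocks (hS : S ⊆ B) (ht : t ∉ B.biUnion id) :
    (mergeBlocks B S t).card + S.card = B.card + 1 := by
  rw [mergeBlocks, Finset.card_insert_of_notMem (merged_notMem_sdiff ht),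
    ← Finset.card_sdiff_add_card_eq_card hS]
  ring

theorem pairwiseDisjoint_mergeBlocks (hS : S ⊆ B) (ht : t ∉ B.biUnion id)
    (hB : (B : Set (Finset (Fin r))).PairwiseDisjoint id) :
    (mergeBlocks B S t : Set (Finset (Fin r))).PairwiseDisjoint id := by
  rw [mergeBlocks, Finset.coe_insert, Set.pairwiseDisjoint_insert_of_notMem
    (by simpa using merged_notMem_sdiff ht)]
  refine ⟨hB.subset (by simp), fun I hI => ?_⟩
  have hI' := Finset.mem_sdiff.1 (Finset.mem_coe.1 hI)
  simp only [id, Finset.disjoint_insert_left, Finset.disjoint_biUnion_left]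
  refine ⟨fun h => ht (Finset.mem_biUnion.2 ⟨I, hI'.1, h⟩), fun K hK => ?_⟩
  exact hB (hS hK) hI'.1 fun h => hI'.2 (h ▸ hK)

theorem empty_notMem_mergeBlocks (hB : ∅ ∉ B) : ∅ ∉ mergeBlocks B S t := fun h => by
  rcases Finset.mem_insert.1 h with h | h
  · exact (Finset.insert_ne_empty _ _) h.symm
  · exact hB (Finset.mem_sdiff.1 h).1

end Merge

variable (A : RealTensor (fun _ : Fin r => Fin d)) (B : Finset (Finset (Fin r)))

theorem measurable_blockNorm : Measurable (A.blockNorm B) := by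
  refine LowerSemicontinuous.measurable (lowerSemicontinuous_iSup fun x =>
    lowerSemicontinuous_iSup fun _ => Continuous.lowerSemicontinuous
      (ENNReal.continuous_ofReal.comp (continuous_abs.comp ?_)))
  unfold blockForm
  fun_prop

variable {B}

theorem le_blockNorm {x : ∀ I : Finset (Fin r), (I → Fin d) → ℝ} (hx : ∀ I, ∑ k, x I k ^ 2 ≤ 1)
    (g : Fin r → Fin d → ℝ) : ENNReal.ofReal |A.blockForm B x g| ≤ A.blockNorm B g :=
  le_iSup₂ (f := fun x _ => ENNReal.ofReal |A.blockForm B x g|) x hx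

theorem blockNorm_congr {g g' : Fin r → Fin d → ℝ} (h : ∀ t ∉ B.biUnion id, g t = g' t) :
    A.blockNorm B g = A.blockNorm B g' := by
  have : ∀ x, A.blockForm B x g = A.blockForm B x g' := fun x =>
    Finset.sum_congr rfl fun i _ => by
      rw [Finset.prod_congr rfl fun t ht => by rw [h t (Finset.mem_compl.1 ht)]]
  simp_rw [blockNorm, this]

/-- The entries of `A` weighted by the vectors `g s`, for the modes `s ≠ t` outside the blocks. -/
noncomputable def weight (B : Finset (Finset (Fin r))) (t : Fin r) (g : Fin r → Fin d → ℝ)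
    (i : Fin r → Fin d) : ℝ :=
  A i * ∏ s ∈ (B.biUnion id)ᶜ.erase t, g s (i s)

/-- Exhibits the form as linear in the vector of mode `t`, in the shape required by the smoothing
argument: the other Gaussians are frozen inside `weight`. -/
theorem blockForm_update {t : Fin r} (ht : t ∉ B.biUnion id)
    (x : ∀ I : Finset (Fin r), (I → Fin d) → ℝ) (g : Fin r → Fin d → ℝ) (z : Fin d → ℝ) :
    A.blockForm B x (Function.update g t z) =
      ∑ k, contraction (fun (I : Finset (Fin r)) (i : Fin r → Fin d) (s : I) => i s)
        (fun i => i t) B (A.weight B t g) x k * z k := by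
  rw [sum_contraction_mul]
  refine Finset.sum_congr rfl fun i _ => ?_
  rw [← Finset.mul_prod_erase _ _ (Finset.mem_compl.2 ht), weight, Function.update_self,
    Finset.prod_congr rfl fun s hs => by rw [Function.update_of_ne (Finset.ne_of_mem_erase hs)]]
  ring

/-- Euclidean duality: the uncontracted modes together form the index of a single vector `u` on the
merged block `U`, and testing against `u/|u|` recovers `|u|`. -/
theorem ofReal_sqrt_partialSqNorm_le_blockNorm {t : Fin r} (ht : t ∉ B.biUnion id)
    {S : Finset (Finset (Fin r))} (hS : S ⊆ B) {x : ∀ I : Finset (Fin r), (I → Fin d) → ℝ}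
    (hx : ∀ I, ∑ k, x I k ^ 2 ≤ 1) (g : Fin r → Fin d → ℝ) :
    ENNReal.ofReal √(partialSqNorm (fun (I : Finset (Fin r)) (i : Fin r → Fin d) (s : I) => i s)
        (fun i => i t) B (A.weight B t g) S x) ≤ A.blockNorm (mergeBlocks B S t) g := by
  set e := fun (I : Finset (Fin r)) (i : Fin r → Fin d) (s : I) => i s with he
  set U := insert t (S.biUnion id) with hU
  set u := contraction e (e U) (B \ S) (A.weight B t g) x with hu
  have hsq : partialSqNorm e (fun i => i t) B (A.weight B t g) S x = ∑ k, u k ^ 2 := by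
    rw [hu, sum_contraction_sq, partialSqNorm]
    refine Finset.sum_congr rfl fun i _ => Finset.sum_congr rfl fun j _ => ?_
    have hiff : (i t = j t ∧ ∀ I ∈ S, e I i = e I j) ↔ e U i = e U j := by
      constructor
      · rintro ⟨h1, h2⟩
        ext ⟨s, hs⟩
        rcases Finset.mem_insert.1 hs with rfl | hs
        · exact congrArg _ h1
        · obtain ⟨I, hI, hsI⟩ := Finset.mem_biUnion.1 hs
          exact congrArg _ (congrFun (h2 I hI) ⟨s, hsI⟩)
      · intro h
        refine ⟨congrFun h ⟨t, Finset.mem_insert_self _ _⟩, fun I hI => ?_⟩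
        ext ⟨s, hs⟩
        exact congrArg _ (congrFun h ⟨s, Finset.mem_insert_of_mem (Finset.mem_biUnion.2 ⟨I, hI, hs⟩)⟩)
    simp only [hiff, Finset.prod_mul_distrib]
    split_ifs
    · ring
    · rfl
  rw [hsq]
  set n := √(∑ k, u k ^ 2) with hn
  rcases eq_or_ne n 0 with h0 | h0
  · simp [h0]
  have hnn : n * n = ∑ k, u k ^ 2 :=
    Real.mul_self_sqrt (Finset.sum_nonneg fun _ _ => sq_nonneg _)
  -- Overwriting `x` at `U` leaves the other blocks alone, because `U` contains `t` and so is not in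
  -- `B \ S`.
  set x' := Function.update x U (fun k => u k / n) with hx'
  have hball : ∀ I, ∑ k, x' I k ^ 2 ≤ 1 := by
    intro I
    rcases eq_or_ne I U with rfl | hI
    · rw [hx', Function.update_self]
      simp_rw [div_pow]
      rw [← Finset.sum_div, ← hnn, sq, div_self (mul_ne_zero h0 h0)]
    · rw [hx', Function.update_of_ne hI]
      exact hx I
  have hval : A.blockForm (mergeBlocks B S t) x' g = n := by
    have h1 : A.blockForm (mergeBlocks B S t) x' g = ∑ k, u k * (u k / n) := by
      rw [hu, sum_contraction_mul, ← hu]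
      refine Finset.sum_congr rfl fun i _ => ?_
      rw [compl_biUnion_mergeBlocks hS, mergeBlocks,
        Finset.prod_insert (merged_notMem_sdiff ht), weight, ← hU, hx', Function.update_self]
      have h2 : ∏ I ∈ B \ S, Function.update x U (fun k => u k / n) I (e I i) =
          ∏ I ∈ B \ S, x I (e I i) := Finset.prod_congr rfl fun I hI => by
        rw [Function.update_of_ne]
        rintro rfl
        exact merged_notMem_sdiff ht hI
      rw [h2]
      ring
    rw [h1]
    simp_rw [← mul_div_assoc, ← sq]
    rw [← Finset.sum_div, ← hnn, mul_div_assoc, div_self h0, mul_one]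
  have := le_blockNorm A (B := mergeBlocks B S t) hball g
  rwa [hval, abs_of_nonneg (Real.sqrt_nonneg _)] at this

/-- Integrating out one Gaussian vector trades it for the merged blocks. -/
theorem lintegral_blockNorm_update_le {t : Fin r} (ht : t ∉ B.biUnion id) {p : ℝ} (hp : 2 ≤ p)
    (g : Fin r → Fin d → ℝ) :
    ∫⁻ z, A.blockNorm B (Function.update g t z) ^ p ∂(gaussianPi (Fin d)) ≤
      (ENNReal.ofReal (√p * Real.exp ((2 ^ r + 2) / 2)) * ∑ S ∈ B.powerset,
        ENNReal.ofReal ((√p)⁻¹ ^ S.card) * A.blockNorm (mergeBlocks B S t) g) ^ p := by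
  have hp0 : 0 < p := by linarith
  set c := √p * Real.exp ((2 ^ r + 2) / 2) with hc
  have hc0 : 0 < c := mul_pos (Real.sqrt_pos.2 hp0) (Real.exp_pos _)
  set e := fun (I : Finset (Fin r)) (i : Fin r → Fin d) (s : I) => i s with he
  rw [← ENNReal.rpow_inv_le_iff hp0, mul_comm, ← ENNReal.div_le_iff_le_mul
    (Or.inl (ENNReal.ofReal_pos.2 hc0).ne') (Or.inl ENNReal.ofReal_ne_top)]
  -- The moment lemma needs `V > 0`, while the target bound may vanish; any `b` strictly above it
  -- gives an admissible `V = b²`.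
  refine le_of_forall_gt_imp_ge_of_dense fun b hb => ?_
  rcases eq_or_ne b ∞ with rfl | hbt
  · exact le_top
  have hb0 : 0 < b.toReal := ENNReal.toReal_pos (pos_of_gt hb).ne' hbt
  rw [ENNReal.div_le_iff_le_mul (Or.inl (ENNReal.ofReal_pos.2 hc0).ne')
    (Or.inl ENNReal.ofReal_ne_top), mul_comm, ENNReal.rpow_inv_le_iff hp0]
  have hV : ∀ x : ∀ I : Finset (Fin r), (I → Fin d) → ℝ, (∀ I, ∑ k, x I k ^ 2 ≤ 1) →
      ∑ S ∈ B.powerset, p⁻¹ ^ S.card *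
        partialSqNorm e (fun i => i t) B (A.weight B t g) S x ≤ b.toReal ^ 2 := by
    intro x hx
    set N := fun S => partialSqNorm e (fun i => i t) B (A.weight B t g) S x with hN
    have h1 : ∑ S ∈ B.powerset, (√p)⁻¹ ^ S.card * √(N S) ≤ b.toReal := by
      rw [← ENNReal.ofReal_le_iff_le_toReal hbt,
        ENNReal.ofReal_sum_of_nonneg fun S _ => by positivity]
      refine (Finset.sum_le_sum fun S hS => ?_).trans hb.le
      rw [ENNReal.ofReal_mul (by positivity)]
      exact mul_le_mul_right
        (ofReal_sqrt_partialSqNorm_le_blockNorm A ht (Finset.mem_powerset.1 hS) hx g) _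
    have h2 : ∀ S, p⁻¹ ^ S.card * N S ≤ ((√p)⁻¹ ^ S.card * √(N S)) ^ 2 := fun S => by
      rw [mul_pow, ← pow_mul, mul_comm S.card 2, pow_mul, inv_pow √p, Real.sq_sqrt hp0.le]
      refine mul_le_mul_of_nonneg_left ?_ (by positivity)
      -- Nonnegativity of `N S` is not needed: if it is negative, the left side is nonpositive.
      rcases le_total 0 (N S) with h | h
      · rw [Real.sq_sqrt h]
      · exact h.trans (sq_nonneg _)
    calc ∑ S ∈ B.powerset, p⁻¹ ^ S.card * N S
        ≤ ∑ S ∈ B.powerset, ((√p)⁻¹ ^ S.card * √(N S)) ^ 2 := Finset.sum_le_sum fun S _ => h2 S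
      _ ≤ (∑ S ∈ B.powerset, (√p)⁻¹ ^ S.card * √(N S)) ^ 2 :=
          Finset.sum_sq_le_sq_sum_of_nonneg fun S _ => by positivity
      _ ≤ b.toReal ^ 2 := pow_le_pow_left₀ (Finset.sum_nonneg fun S _ => by positivity) h1 2
  have h := lintegral_iSup_contraction_rpow_le e (fun i => i t) B (A.weight B t g) hp
    (pow_pos hb0 2) hV
  -- The family `x` is indexed by all subsets of the modes, not only those in `B`; hence the `2 ^ r`
  -- in the constant.
  rw [Real.sqrt_sq hb0.le, Fintype.card_finset, Fintype.card_fin, Nat.cast_pow, Nat.cast_ofNat,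
    ← hc, ENNReal.ofReal_mul hc0.le, ENNReal.ofReal_toReal hbt] at h
  simp_rw [blockNorm, blockForm_update A ht]
  exact h

/-- Once the blocks cover all modes, no Gaussian factor remains, and an index tuple is the same as a
family of tuples, one per block. -/
theorem abs_blockForm_parts_le_injectiveNorm
    (P : Finpartition (Finset.univ : Finset (Fin r))) (hP : P.parts.Nonempty)
    {x : ∀ I : Finset (Fin r), (I → Fin d) → ℝ} (hx : ∀ I, ∑ k, x I k ^ 2 ≤ 1)
    (g : Fin r → Fin d → ℝ) :
    |A.blockForm P.parts x g| ≤ (A.regroup P).injectiveNorm := by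
  have hunion : P.parts.biUnion id = Finset.univ := P.biUnion_parts
  have hval : A.blockForm P.parts x g = (A.regroup P).eval fun I => WithLp.toLp 2 (x I.1) := by
    let Φ : (Fin r → Fin d) ≃ (∀ I : {I : Finset (Fin r) // I ∈ P.parts}, I.1 → Fin d) :=
      { toFun := fun i I t => i t
        invFun := fun j t =>
          j ⟨P.part t, P.part_mem.2 (Finset.mem_univ t)⟩ ⟨t, P.mem_part (Finset.mem_univ t)⟩
        left_inv := fun i => rfl
        right_inv := fun j => by
          have h : ∀ (I I' : {I : Finset (Fin r) // I ∈ P.parts}) (t : Fin r) (h : t ∈ I.1)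
              (h' : t ∈ I'.1), I = I' → j I ⟨t, h⟩ = j I' ⟨t, h'⟩ := by
            rintro I _ t h h' rfl
            rfl
          ext I ⟨t, ht⟩
          exact congrArg _ (h _ _ t _ _ (Subtype.ext (P.part_eq_of_mem I.2 ht))) }
    refine Fintype.sum_equiv Φ _ _ fun i => ?_
    rw [hunion, Finset.compl_univ, Finset.prod_empty, mul_one, ← Finset.prod_coe_sort]
    rfl
  rw [hval]
  obtain ⟨I, hI⟩ := hP
  refine abs_eval_le_injectiveNorm _ ⟨I, hI⟩ fun I => ?_
  rw [EuclideanSpace.norm_eq, Real.sqrt_le_one]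
  simpa using hx I.1

end RealTensor

/-! ### Moments of block norms and the induction over uncovered modes. -/

theorem lintegral_Lp_sum_le {Ω α : Type*} [MeasurableSpace Ω] {μ : Measure Ω} {p : ℝ} (hp : 1 ≤ p)
    (s : Finset α) (f : α → Ω → ℝ≥0∞) (hf : ∀ a, Measurable (f a)) :
    (∫⁻ ω, (∑ a ∈ s, f a ω) ^ p ∂μ) ^ (1 / p) ≤ ∑ a ∈ s, (∫⁻ ω, f a ω ^ p ∂μ) ^ (1 / p) := by
  classical
  have hp0 : 0 < p := by linarith
  induction s using Finset.induction_on with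
  | empty => simp [ENNReal.zero_rpow_of_pos, hp0]
  | insert a s ha ih =>
    simp_rw [Finset.sum_insert ha]
    have h := ENNReal.lintegral_Lp_add_le (hf a).aemeasurable (μ := μ)
      (Finset.measurable_sum s fun a _ => hf a).aemeasurable hp
    simp only [Pi.add_apply] at h
    exact h.trans (add_le_add le_rfl ih)

theorem lintegral_Lp_const_mul {Ω : Type*} [MeasurableSpace Ω] {μ : Measure Ω} {p : ℝ}
    (hp : 0 < p) (c : ℝ≥0∞) {f : Ω → ℝ≥0∞} (hf : Measurable f) :
    (∫⁻ ω, (c * f ω) ^ p ∂μ) ^ (1 / p) = c * (∫⁻ ω, f ω ^ p ∂μ) ^ (1 / p) := by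
  simp_rw [ENNReal.mul_rpow_of_nonneg _ _ hp.le]
  rw [lintegral_const_mul _ (hf.pow_const p), ENNReal.mul_rpow_of_nonneg _ _ (by positivity),
    ← ENNReal.rpow_mul, mul_one_div_cancel hp.ne', ENNReal.rpow_one]

namespace RealTensor

variable {r d : ℕ} (A : RealTensor (fun _ : Fin r => Fin d))

/-- The weighted `p`-th moment `p ^ (|B| / 2) * ‖blockNorm A B‖_p` for Gaussian vectors. -/
noncomputable def blockMoment (p : ℝ) (B : Finset (Finset (Fin r))) : ℝ≥0∞ :=
  ENNReal.ofReal (√p ^ B.card) *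
    (∫⁻ g, A.blockNorm B g ^ p ∂(gaussianPiPi fun _ : Fin r => Fin d)) ^ (1 / p)

/-- The right-hand side of the moment estimate, without its constant. -/
noncomputable def partitionSum (p : ℝ) : ℝ :=
  ∑ P : Finpartition (Finset.univ : Finset (Fin r)),
    √p ^ P.parts.card * (A.regroup P).injectiveNorm

theorem parts_nonempty (hr : 1 ≤ r) (P : Finpartition (Finset.univ : Finset (Fin r))) :
    P.parts.Nonempty :=
  P.parts_nonempty (Finset.univ_nonempty_iff.2 ⟨⟨0, hr⟩⟩).ne_empty

/-- One step of the induction: integrate out `g_t`, then apply Minkowski to the sum over `S`. The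
weights in `blockMoment` absorb every power of `p`. -/
theorem blockMoment_le_sum_mergeBlocks {p : ℝ} (hp : 2 ≤ p) {B : Finset (Finset (Fin r))}
    {t : Fin r} (ht : t ∉ B.biUnion id) :
    A.blockMoment p B ≤ ENNReal.ofReal (Real.exp ((2 ^ r + 2) / 2)) *
      ∑ S ∈ B.powerset, A.blockMoment p (mergeBlocks B S t) := by
  have hp0 : 0 < p := by linarith
  have hsp : 0 < √p := Real.sqrt_pos.2 hp0
  set c := Real.exp ((2 ^ r + 2) / 2) with hc
  have hc0 : 0 < c := Real.exp_pos _
  have hm : ∀ S, Measurable fun g => ENNReal.ofReal ((√p)⁻¹ ^ S.card) *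
      A.blockNorm (mergeBlocks B S t) g := fun S => (A.measurable_blockNorm _).const_mul _
  have hms : Measurable fun g => ∑ S ∈ B.powerset, ENNReal.ofReal ((√p)⁻¹ ^ S.card) *
      A.blockNorm (mergeBlocks B S t) g := Finset.measurable_sum _ fun S _ => hm S
  have h1 : ∫⁻ g, A.blockNorm B g ^ p ∂(gaussianPiPi fun _ : Fin r => Fin d) ≤
      ∫⁻ g, (ENNReal.ofReal (√p * c) * ∑ S ∈ B.powerset,
        ENNReal.ofReal ((√p)⁻¹ ^ S.card) * A.blockNorm (mergeBlocks B S t) g) ^ p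
          ∂(gaussianPiPi fun _ : Fin r => Fin d) := by
    -- Only coordinate `t` is integrated; the right side does not depend on it, as `t` lies in the
    -- merged block for every `S`.
    refine lintegral_le_of_lmarginal_le {t} ((A.measurable_blockNorm B).pow_const p)
      ((hms.const_mul _).pow_const p) ?_
    rw [lmarginal_singleton, lmarginal_singleton]
    intro g
    dsimp only
    have h2 : ∀ z : Fin d → ℝ, (∑ S ∈ B.powerset, ENNReal.ofReal ((√p)⁻¹ ^ S.card) *
        A.blockNorm (mergeBlocks B S t) (Function.update g t z)) =
        ∑ S ∈ B.powerset, ENNReal.ofReal ((√p)⁻¹ ^ S.card) *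
          A.blockNorm (mergeBlocks B S t) g := fun z => by
      refine Finset.sum_congr rfl fun S hS => ?_
      congr 1
      refine blockNorm_congr A fun s hs => Function.update_of_ne ?_ _ _
      rintro rfl
      rw [biUnion_mergeBlocks (Finset.mem_powerset.1 hS)] at hs
      exact hs (Finset.mem_insert_self _ _)
    simp_rw [h2]
    rw [lintegral_const, measure_univ, mul_one]
    exact A.lintegral_blockNorm_update_le ht hp g
  calc A.blockMoment p B
      ≤ ENNReal.ofReal (√p ^ B.card) * (ENNReal.ofReal (√p * c) * ∑ S ∈ B.powerset,
          ENNReal.ofReal ((√p)⁻¹ ^ S.card) *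
          (∫⁻ g, A.blockNorm (mergeBlocks B S t) g ^ p
            ∂(gaussianPiPi fun _ : Fin r => Fin d)) ^ (1 / p)) := by
        refine mul_le_mul_right ((ENNReal.rpow_le_rpow h1 (by positivity)).trans ?_) _
        rw [lintegral_Lp_const_mul hp0 _ hms]
        refine mul_le_mul_right ((lintegral_Lp_sum_le (by linarith) _ _ hm).trans_eq ?_) _
        exact Finset.sum_congr rfl fun S _ =>
          lintegral_Lp_const_mul hp0 _ (A.measurable_blockNorm _)
    _ = _ := by
        rw [Finset.mul_sum, Finset.mul_sum, Finset.mul_sum]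
        refine Finset.sum_congr rfl fun S hS => ?_
        rw [blockMoment, ← mul_assoc, ← mul_assoc, ← mul_assoc, ← ENNReal.ofReal_mul (by positivity),
          ← ENNReal.ofReal_mul (by positivity), ← ENNReal.ofReal_mul (by positivity)]
        congr 2
        have hcard := card_mergeBlocks (Finset.mem_powerset.1 hS) ht
        have h3 : √p ^ B.card * √p = √p ^ (mergeBlocks B S t).card * √p ^ S.card := by
          rw [← pow_succ, ← pow_add, hcard]
        rw [inv_pow, ← mul_assoc, h3]
        field_simp

theorem blockMoment_parts_le (hr : 1 ≤ r) {p : ℝ} (hp : 2 ≤ p)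
    (P : Finpartition (Finset.univ : Finset (Fin r))) :
    A.blockMoment p P.parts ≤ ENNReal.ofReal (A.partitionSum p) := by
  have hp0 : 0 < p := by linarith
  have hnn : ∀ P : Finpartition (Finset.univ : Finset (Fin r)),
      0 ≤ (A.regroup P).injectiveNorm := fun P => by
    obtain ⟨I, hI⟩ := parts_nonempty hr P
    exact injectiveNorm_nonneg _ ⟨I, hI⟩
  have h1 : ∀ g, A.blockNorm P.parts g ≤ ENNReal.ofReal (A.regroup P).injectiveNorm := fun g =>
    iSup₂_le fun x hx => ENNReal.ofReal_le_ofReal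
      (A.abs_blockForm_parts_le_injectiveNorm P (parts_nonempty hr P) hx g)
  have h2 : (∫⁻ g, A.blockNorm P.parts g ^ p ∂(gaussianPiPi fun _ : Fin r => Fin d)) ^ (1 / p) ≤
      ENNReal.ofReal (A.regroup P).injectiveNorm := by
    rw [one_div, ENNReal.rpow_inv_le_iff hp0]
    refine (lintegral_mono fun g => ENNReal.rpow_le_rpow (h1 g) hp0.le).trans_eq ?_
    rw [lintegral_const, measure_univ, mul_one]
  refine (mul_le_mul_right h2 _).trans ?_
  rw [← ENNReal.ofReal_mul (by positivity)]
  exact ENNReal.ofReal_le_ofReal (Finset.single_le_sum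
    (f := fun P : Finpartition (Finset.univ : Finset (Fin r)) =>
      √p ^ P.parts.card * (A.regroup P).injectiveNorm)
    (fun P _ => mul_nonneg (by positivity) (hnn P)) (Finset.mem_univ P))

/-- Induction on the number `n` of modes outside the blocks. Each step covers one more mode and
costs the constant of the single step times a crude bound on the number of choices of `S`; at `n =
0` the blocks form a partition. -/
theorem blockMoment_le (hr : 1 ≤ r) {p : ℝ} (hp : 2 ≤ p) (n : ℕ)
    (B : Finset (Finset (Fin r))) (hdisj : (B : Set (Finset (Fin r))).PairwiseDisjoint id)
    (hne : ∅ ∉ B) (hn : (B.biUnion id)ᶜ.card = n) :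
    A.blockMoment p B ≤ (ENNReal.ofReal (Real.exp ((2 ^ r + 2) / 2)) *
      Fintype.card (Finset (Finset (Fin r)))) ^ n * ENNReal.ofReal (A.partitionSum p) := by
  induction n generalizing B with
  | zero =>
    rw [Finset.card_eq_zero, Finset.compl_eq_empty_iff] at hn
    rw [pow_zero, one_mul]
    exact A.blockMoment_parts_le hr hp
      { parts := B
        supIndep := Finset.supIndep_iff_pairwiseDisjoint.2 hdisj
        sup_parts := by rw [Finset.sup_eq_biUnion, hn]
        bot_notMem := hne }
  | succ n ih =>
    obtain ⟨t, ht⟩ := Finset.card_pos.1 (hn.symm ▸ Nat.succ_pos n : 0 < (B.biUnion id)ᶜ.card)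
    rw [Finset.mem_compl] at ht
    set D := ENNReal.ofReal (Real.exp ((2 ^ r + 2) / 2)) *
      Fintype.card (Finset (Finset (Fin r))) with hD
    refine (A.blockMoment_le_sum_mergeBlocks hp ht).trans ?_
    calc ENNReal.ofReal (Real.exp ((2 ^ r + 2) / 2)) *
          ∑ S ∈ B.powerset, A.blockMoment p (mergeBlocks B S t)
        ≤ ENNReal.ofReal (Real.exp ((2 ^ r + 2) / 2)) *
          ∑ _S ∈ B.powerset, D ^ n * ENNReal.ofReal (A.partitionSum p) := by
          refine mul_le_mul_right (Finset.sum_le_sum fun S hS => ?_) _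
          have hS' := Finset.mem_powerset.1 hS
          refine ih _ (pairwiseDisjoint_mergeBlocks hS' ht hdisj) (empty_notMem_mergeBlocks hne) ?_
          rw [compl_biUnion_mergeBlocks hS', Finset.card_erase_of_mem (Finset.mem_compl.2 ht), hn,
            Nat.add_sub_cancel]
      _ ≤ ENNReal.ofReal (Real.exp ((2 ^ r + 2) / 2)) * (Fintype.card (Finset (Finset (Fin r))) *
          (D ^ n * ENNReal.ofReal (A.partitionSum p))) := by
          rw [Finset.sum_const, nsmul_eq_mul]
          refine mul_le_mul_right (mul_le_mul_left ?_ _) _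
          exact_mod_cast Finset.card_le_univ _
      _ = _ := by rw [pow_succ, hD]; ring

theorem ofReal_abs_le_blockNorm_empty (g : Fin r → Fin d → ℝ) :
    ENNReal.ofReal |∑ i : Fin r → Fin d, A i * ∏ t, g t (i t)| ≤ A.blockNorm ∅ g := by
  have h := le_blockNorm A (B := ∅) (x := fun _ _ => 0) (by simp) g
  simpa [blockForm] using h

end RealTensor

/-! ### Transfer to arbitrary probability spaces and the final estimate. -/

theorem map_ofLp_eq_gaussianPiPi {r d : ℕ} {Ω : Type*} [MeasurableSpace Ω] {μ : Measure Ω}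
    [IsProbabilityMeasure μ] {g : Fin r → Ω → EuclideanSpace ℝ (Fin d)}
    (hg : ∀ t, HasLaw (g t) (stdGaussian (EuclideanSpace ℝ (Fin d))) μ) (hi : iIndepFun g μ) :
    μ.map (fun ω t => (g t ω).ofLp) = gaussianPiPi fun _ : Fin r => Fin d := by
  have hof : Measurable (WithLp.ofLp : EuclideanSpace ℝ (Fin d) → (Fin d → ℝ)) := by fun_prop
  have hm : ∀ t, AEMeasurable (fun ω => (g t ω).ofLp) μ := fun t =>
    hof.comp_aemeasurable (hg t).aemeasurable
  have hi' : iIndepFun (fun t ω => (g t ω).ofLp) μ := hi.comp (fun _ => WithLp.ofLp) fun _ => hof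
  rw [(iIndepFun_iff_map_fun_eq_pi_map hm).1 hi']
  congr 1
  ext1 t
  have h1 : μ.map (fun ω => (g t ω).ofLp) = (μ.map (g t)).map WithLp.ofLp :=
    (AEMeasurable.map_map_of_aemeasurable hof.aemeasurable (hg t).aemeasurable).symm
  rw [h1, (hg t).map_eq, ← map_pi_eq_stdGaussian, Measure.map_map hof (by fun_prop)]
  exact Measure.map_id

theorem theorem2 (r : ℕ) (hr : 1 ≤ r) :
    ∃ C : ℝ, ∀ (d : ℕ) (A : RealTensor (fun _ : Fin r => Fin d))
      (Ω : Type*) [MeasurableSpace Ω] (μ : Measure Ω) [IsProbabilityMeasure μ]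
      (g : Fin r → Ω → EuclideanSpace ℝ (Fin d)),
      (∀ t, HasLaw (g t) (stdGaussian (EuclideanSpace ℝ (Fin d))) μ) →
      iIndepFun g μ →
      ∀ p : ℝ, 2 ≤ p →
        Integrable (fun ω => |A.chaos g ω| ^ p) μ ∧
        (∫ ω, |A.chaos g ω| ^ p ∂μ) ^ (1 / p) ≤
          C * ∑ P : Finpartition (Finset.univ : Finset (Fin r)),
            p ^ ((P.parts.card : ℝ) / 2) * (A.regroup P).injectiveNorm := by
  refine ⟨(Real.exp ((2 ^ r + 2) / 2) * Fintype.card (Finset (Finset (Fin r)))) ^ r, ?_⟩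
  intro d A Ω _ μ _ g hg hi p hp
  have hp0 : 0 < p := by linarith
  set C := (Real.exp ((2 ^ r + 2) / 2) * Fintype.card (Finset (Finset (Fin r)))) ^ r with hC
  have hC0 : 0 ≤ C := by positivity
  have hsum : ∑ P : Finpartition (Finset.univ : Finset (Fin r)),
      p ^ ((P.parts.card : ℝ) / 2) * (A.regroup P).injectiveNorm = A.partitionSum p :=
    Finset.sum_congr rfl fun P _ => by
      rw [Real.sqrt_eq_rpow, ← Real.rpow_mul_natCast hp0.le, one_div_mul_eq_div]
  rw [hsum]
  have hS0 : 0 ≤ A.partitionSum p := Finset.sum_nonneg fun P _ => by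
    obtain ⟨I, hI⟩ := RealTensor.parts_nonempty hr P
    exact mul_nonneg (by positivity) (RealTensor.injectiveNorm_nonneg _ ⟨I, hI⟩)
  have hmoment : (∫⁻ x, A.blockNorm ∅ x ^ p ∂(gaussianPiPi fun _ : Fin r => Fin d)) ^ (1 / p) ≤
      ENNReal.ofReal (C * A.partitionSum p) := by
    -- With no blocks, all `r` modes are Gaussian and the weight is `√p ^ 0 = 1`.
    have h := A.blockMoment_le hr hp r ∅ (by simp) (by simp) (by simp)
    rw [RealTensor.blockMoment, Finset.card_empty, pow_zero, ENNReal.ofReal_one, one_mul] at h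
    rwa [← ENNReal.ofReal_natCast, ← ENNReal.ofReal_mul (Real.exp_pos _).le,
      ← ENNReal.ofReal_pow (by positivity), ← ENNReal.ofReal_mul hC0] at h
  have hof : Measurable (WithLp.ofLp : EuclideanSpace ℝ (Fin d) → (Fin d → ℝ)) := by fun_prop
  have hG : AEMeasurable (fun ω t => (g t ω).ofLp) μ := aemeasurable_pi_lambda _ fun t =>
    hof.comp_aemeasurable (hg t).aemeasurable
  -- The bound in `ℝ≥0∞` comes before integrability and implies it; only then is it read as a bound
  -- on the real integral.
  have hlin : ∫⁻ ω, ENNReal.ofReal (|A.chaos g ω| ^ p) ∂μ ≤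
      ENNReal.ofReal (C * A.partitionSum p) ^ p := by
    rw [one_div, ENNReal.rpow_inv_le_iff hp0, ← map_ofLp_eq_gaussianPiPi hg hi,
      lintegral_map' ((A.measurable_blockNorm ∅).pow_const p).aemeasurable hG] at hmoment
    refine le_trans (lintegral_mono fun ω => ?_) hmoment
    rw [← ENNReal.ofReal_rpow_of_nonneg (abs_nonneg _) hp0.le]
    exact ENNReal.rpow_le_rpow (A.ofReal_abs_le_blockNorm_empty _) hp0.le
  have hmeas : AEMeasurable (fun ω => |A.chaos g ω| ^ p) μ := by
    have h1 : Measurable fun x : Fin r → Fin d → ℝ =>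
        |∑ i : Fin r → Fin d, A i * ∏ t, x t (i t)| ^ p := by fun_prop
    exact h1.comp_aemeasurable hG
  have hnn : ∀ ω, 0 ≤ |A.chaos g ω| ^ p := fun ω => Real.rpow_nonneg (abs_nonneg _) _
  have hint : Integrable (fun ω => |A.chaos g ω| ^ p) μ := by
    refine ⟨hmeas.aestronglyMeasurable, ?_⟩
    rw [hasFiniteIntegral_iff_ofReal (Filter.Eventually.of_forall hnn)]
    exact hlin.trans_lt (ENNReal.rpow_lt_top_of_nonneg hp0.le ENNReal.ofReal_ne_top)
  refine ⟨hint, ?_⟩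
  rw [← ofReal_integral_eq_lintegral_ofReal hint (Filter.Eventually.of_forall hnn),
    ENNReal.ofReal_rpow_of_nonneg (mul_nonneg hC0 hS0) hp0.le,
    ENNReal.ofReal_le_ofReal_iff (Real.rpow_nonneg (mul_nonneg hC0 hS0) _)] at hlin
  rw [one_div]
  exact (Real.rpow_inv_le_iff_of_pos (integral_nonneg hnn) (mul_nonneg hC0 hS0) hp0).2 hlin
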